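/- Let $T, L, \ell$ be integers with $1\le L\le T-1$ and $1\le \ell\le T-1$, and let $0\le \underline C\le\overline V\le\overline C$ and $V>0$ be real numbers. Write $[a,b]_{\mathbb Z}=\{i\in\mathbb Z: a\le i\le b\}$ (empty if $a>b$) and $[a]^+=\max\{a,0\}$; an empty sum is $0$. Let $P$ be the set of all $(x,y,u)$ with $x=(x_1,\dots,x_T)\in\mathbb R_+^T$, $y=(y_1,\dots,y_T)\in\{0,1\}^T$, $u=(u_2,\dots,u_T)\in\{0,1\}^{T-1}$ such that - $\sum_{i=t-L+1}^{t}u_i\le y_t$ for $t\in[L+1,T]_{\mathbb Z}$, and $\sum_{i=t-\ell+1}^{t}u_i\le 1-y_{t-\ell}$ for $t\in[\ell+1,T]_{\mathbb Z}$; - $y_t-y_{t-1}-u_t\le 0$ for $t\in[2,T]_{\mathbb Z}$, and $\underline C y_t\le x_t\le\overline C y_t$ for $t\in[1,T]_{\mathbb Z}$; - $x_t-x_{t-1}\le V y_{t-1}+\overline V(1-y_{t-1})$ and $x_{t-1}-x_t\le V y_t+\overline V(1-y_t)$ for $t\in[2,T]_{\mathbb Z}$. Let $\mathrm{conv}(P)$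 be its convex hull. For $t\in[1,T-1]_{\mathbb Z}$ put $\hat t=t+\min\{t-2,L-2\}$ if $\min\{t-2,L-2\}\ge L/2$, and $\hat t=\max\{t+1,L+1\}$ otherwise. Let $m$ be an integer with $[\hat t-t-1]^+\le m\le\min\{T-t-1,(\overline C-\overline V)/V\}$, let $S_0=[t+1,\hat t-1]_{\mathbb Z}$ and let $S\subseteq[\hat t+1,t+m]_{\mathbb Z}$. For $i\in S\cup\{\hat t\}$ let $d_i=\min\{a\in S\cup\{t+m+1\}:a>i\}$, with $d_i=t+m+1$ if this set is empty (which happens only for $m=\hat t-t-1$, $i=\hat t=t+m+1$, $S=\emptyset$), and let $$\phi(u,t)=V\sum_{k=1}^{t+L-T-1}k\,u_{t-k}+V\sum_{k=[t+L-T]^+}^{\min\{L-1,t-2\}}\min\{L-1-k,k\}\,u_{t-k}.$$ Then the inequality $$x_t\le\overline V y_t+V\sum_{i\in S_0}\Bigl(y_i-\sum_{j=0}^{\min\{L-1,i-2\}}u_{i-j}\Bigr)+V\sum_{i\in S\cup\{\hat t\}}(d_i-i)\Bigl(y_i-\sum_{j=0}^{L-1}u_{i-j}\Bigr)+(\overline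 C-\overline V-mV)\Bigl(y_{t+m+1}-\sum_{j=0}^{L-1}u_{t+m+1-j}\Bigr)+\phi(u,t)$$ is valid for $\mathrm{conv}(P)$, i.e. it holds at every point of $\mathrm{conv}(P)$. Suppose moreover that $\underline C<\overline C$, and that $m\ge\hat t-t$ or, in the remaining boundary case $m=\hat t-t-1$, that $\lfloor (L-1)/2\rfloor V\le\overline C-\overline V$. Then the inequality is facet-defining for $\mathrm{conv}(P)$, i.e. it is valid and the points of $\mathrm{conv}(P)$ satisfying it at equality form a non-empty face of dimension $\dim\mathrm{conv}(P)-1$. -/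

import Mathlib

namespace RampPolytope

/-- The space of triples `(x, y, u)`, where `x` and `y` are indexed by the integers `1, …, T` and
`u` is indexed by the integers `2, …, T`. -/
abbrev Point (T : ℤ) : Type :=
  (Finset.Icc (1 : ℤ) T → ℝ) × (Finset.Icc (1 : ℤ) T → ℝ) × (Finset.Icc (2 : ℤ) T → ℝ)

namespace Point

variable {T : ℤ}

/-- The generation amount `x_i` (`0` outside the index range, a value that is never used). -/
noncomputable def x (p : Point T) (i : ℤ) : ℝ := if h : i ∈ Finset.Icc (1 : ℤ) T then p.1 ⟨i, h⟩ else 0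

/-- The online status `y_i` (`0` outside the index range, a value that is never used). -/
noncomputable def y (p : Point T) (i : ℤ) : ℝ := if h : i ∈ Finset.Icc (1 : ℤ) T then p.2.1 ⟨i, h⟩ else 0

/-- The start-up indicator `u_i` (`0` outside the index range, a value that is never used). -/
noncomputable def u (p : Point T) (i : ℤ) : ℝ := if h : i ∈ Finset.Icc (2 : ℤ) T then p.2.2 ⟨i, h⟩ else 0

end Point

/-- The integrated minimum-up-time, minimum-down-time and ramping set `P`: `T` is the horizon, `L` and `l` are
the minimum-up and minimum-down times, `Cl` and `Cu` the lower and upper generation bounds, `Vb` the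
start-up and shut-down ramp rate and `V` the ramp rate in the stable region. -/
structure Feasible (T L l : ℤ) (Cl Cu Vb V : ℝ) (p : Point T) : Prop where
  x_nonneg : ∀ t ∈ Finset.Icc 1 T, 0 ≤ p.x t
  y_binary : ∀ t ∈ Finset.Icc 1 T, p.y t = 0 ∨ p.y t = 1
  u_binary : ∀ t ∈ Finset.Icc 2 T, p.u t = 0 ∨ p.u t = 1
  min_up : ∀ t ∈ Finset.Icc (L + 1) T, ∑ i ∈ Finset.Icc (t - L + 1) t, p.u i ≤ p.y t
  min_down : ∀ t ∈ Finset.Icc (l + 1) T, ∑ i ∈ Finset.Icc (t - l + 1) t, p.u i ≤ 1 - p.y (t - l)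
  start_up : ∀ t ∈ Finset.Icc 2 T, p.y t - p.y (t - 1) - p.u t ≤ 0
  lower_bound : ∀ t ∈ Finset.Icc 1 T, -p.x t + Cl * p.y t ≤ 0
  upper_bound : ∀ t ∈ Finset.Icc 1 T, p.x t - Cu * p.y t ≤ 0
  ramp_up : ∀ t ∈ Finset.Icc 2 T, p.x t - p.x (t - 1) ≤ V * p.y (t - 1) + Vb * (1 - p.y (t - 1))
  ramp_down : ∀ t ∈ Finset.Icc 2 T, p.x (t - 1) - p.x t ≤ V * p.y t + Vb * (1 - p.y t)

/-- `conv(P)`. -/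
noncomputable def convP (T L l : ℤ) (Cl Cu Vb V : ℝ) : Set (Point T) :=
  convexHull ℝ {p | Feasible T L l Cl Cu Vb V p}

/-- The inequality `f ≤ g` is valid for `Q`. -/
def IsValid {E : Type*} (Q : Set E) (f g : E → ℝ) : Prop := ∀ p ∈ Q, f p ≤ g p

/-- The inequality `f ≤ g` is facet-defining for `Q`: it is valid for `Q`, and the points of `Q`
that satisfy it at equality form a non-empty face of dimension `dim Q - 1`. -/
def IsFacetDefining {E : Type*} [AddCommGroup E] [Module ℝ E] (Q : Set E) (f g : E → ℝ) : Prop :=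
  IsValid Q f g ∧ {p ∈ Q | f p = g p}.Nonempty ∧
    Module.finrank ℝ (vectorSpan ℝ {p ∈ Q | f p = g p}) + 1 = Module.finrank ℝ (vectorSpan ℝ Q)

/-- The time index `t̂`. -/
def tHat (L t : ℤ) : ℤ :=
  if L ≤ 2 * min (t - 2) (L - 2) then t + min (t - 2) (L - 2) else max (t + 1) (L + 1)

/-- `d_i = min {a ∈ S ∪ {e} : a > i}`, used with `e = t + m + 1`. If no element of `S ∪ {e}` exceeds
`i` (which happens only for `i = t̂ = t + m + 1`, where `S` is empty), then `d_i = e`. -/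
def nextIdx (S : Finset ℤ) (e i : ℤ) : ℤ :=
  if h : {a ∈ insert e S | i < a}.Nonempty then {a ∈ insert e S | i < a}.min' h else e

/-- `φ(u, t)`. -/
noncomputable def phi {T : ℤ} (L : ℤ) (V : ℝ) (t : ℤ) (p : Point T) : ℝ :=
  V * ∑ k ∈ Finset.Icc 1 (t + L - T - 1), (k : ℝ) * p.u (t - k) +
    V * ∑ k ∈ Finset.Icc (max (t + L - T) 0) (min (L - 1) (t - 2)),
      ((min (L - 1 - k) k : ℤ) : ℝ) * p.u (t - k)

/-- The right-hand side of the upper bound on `x_t` given by `t`, `m` and `S`. -/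
noncomputable def rhs {T : ℤ} (L : ℤ) (Cu Vb V : ℝ) (t m : ℤ) (S : Finset ℤ) (p : Point T) : ℝ :=
  Vb * p.y t +
    V * ∑ i ∈ Finset.Icc (t + 1) (tHat L t - 1),
      (p.y i - ∑ j ∈ Finset.Icc 0 (min (L - 1) (i - 2)), p.u (i - j)) +
    V * ∑ i ∈ insert (tHat L t) S, ((nextIdx S (t + m + 1) i - i : ℤ) : ℝ) *
      (p.y i - ∑ j ∈ Finset.Icc 0 (L - 1), p.u (i - j)) +
    (Cu - Vb - m * V) * (p.y (t + m + 1) - ∑ j ∈ Finset.Icc 0 (L - 1), p.u (t + m + 1 - j)) +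
    phi L V t p

end RampPolytope

/-!
The inequality bounds the generation at time `t` of a unit whose status sequence is known. Write
`settled` for the status at a time `i` reduced by the start-ups in the last `L` periods; at a
feasible point this is `1` if the unit is online at `i` and has been so during the `L` periods before
`i` (or since the first period), and `0` otherwise.

*Validity.* By convexity it suffices to consider feasible points. If the unit is offline at time `t`,
all terms are nonnegative. Otherwise let `[s, r - 1]` be the maximal run of online periods around
`t`. The generation at time `t` is at most `Cu`, at most `Vb + V (r - 1 - t)` if the unit shuts down,
and at most `Vb + V (t - s)` if it has started up. The settled periods of the run after `t` start at
some `a`, which is `t + 1` unless the start-up is recent. Since the gaps `d_i - i` telescope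
(`sum_nextIdx_sub`), the terms with index after `t` contribute at least `V (r - a)`, or
`V (t + m + 1 - a) + (Cu - Vb - m V)` if the run extends beyond `t + m + 1` (`sum_settled_ge`). The
term `φ` either pays for the whole ramp-up, or for the periods from `t + 1` to `a - 1`; the definition
of `t̂` is what makes `a ≤ t̂` in the second case (`Feasible.x_le_rhs`).

*Facets.* The origin is tight, so the span of the tight points is the direction of the face. Together
with the unit vector of `x_t` it is the whole space (`FacetSetting.eq_top_of_tight_mem`), whence the
face has codimension at most one; it is a proper face since the slack does not vanish identically.
Lowering single coordinates `x_i` of the always-on point at full capacity gives the units of `x`, so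
only the statuses of the tight points matter from then on. The tight points used are single runs
`[a, b]` whose generation is a tent with its peak at time `t`:

* runs of the minimal length `L` (cut off at the end of the horizon) after a start-up at any time,
* runs of length `L + 1` whose last period is after `t̂` and outside `S ∪ {t + m + 1}`,
* initial runs that are followed by an offline period in `[1, t̂] ∪ S ∪ {t + m + 1}`, or that last
  throughout the horizon.

The difference of the first two kinds is a unit of `y`. Subtracting such units from longer initial
runs yields all initial runs, hence all units of `y`, and finally all units of `u`. The assumption on
`⌊(L - 1) / 2⌋` guarantees that the capacity admits the peaks required by `φ`
(`FacetSetting.mul_le`).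
-/

namespace RampPolytope

open Finset

/-! ### Minimum-time consequences -/

/-- The online status at time `i`, reduced by the start-ups in the window `[i - L + 1, i]`: for a
feasible point it is `1` if the unit is online at `i` and has been so during the `L` periods before
`i` (or since time `1`), and `0` otherwise. -/
noncomputable def settled {T : ℤ} (L : ℤ) (p : Point T) (i : ℤ) : ℝ :=
  p.y i - ∑ j ∈ Icc 0 (L - 1), p.u (i - j)

section Basic

variable {T : ℤ}

lemma Point.u_eq_zero {p : Point T} {i : ℤ} (h : i < 2 ∨ T < i) : p.u i = 0 := by
  unfold Point.u
  rw [dif_neg]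
  simp only [mem_Icc]
  omega

lemma sum_window (f : ℤ → ℝ) (L i : ℤ) :
    ∑ j ∈ Icc 0 (L - 1), f (i - j) = ∑ j ∈ Icc (i - L + 1) i, f j := by
  refine Finset.sum_nbij' (fun j => i - j) (fun j => i - j) ?_ ?_ ?_ ?_ ?_ <;>
    simp only [mem_Icc] <;> intros <;> first | omega | simp

lemma rhs_eq_settled (L : ℤ) (Cu Vb V : ℝ) (t m : ℤ) (S : Finset ℤ) (p : Point T) :
    rhs L Cu Vb V t m S p = Vb * p.y t + V * ∑ i ∈ Icc (t + 1) (tHat L t - 1), settled L p i +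
      V * ∑ i ∈ insert (tHat L t) S, ((nextIdx S (t + m + 1) i - i : ℤ) : ℝ) * settled L p i +
      (Cu - Vb - m * V) * settled L p (t + m + 1) + phi L V t p := by
  have h : ∀ i, ∑ j ∈ Icc 0 (min (L - 1) (i - 2)), p.u (i - j) = ∑ j ∈ Icc 0 (L - 1), p.u (i - j) := by
    intro i
    apply Finset.sum_subset
    · intro j; simp only [mem_Icc]; omega
    · intro j; simp only [mem_Icc]; intro h1 h2
      exact Point.u_eq_zero (by omega)
  simp only [rhs, settled, h]

end Basic

namespace Feasible

variable {T L l : ℤ} {Cl Cu Vb V : ℝ} {p : Point T}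

lemma u_nonneg (hp : Feasible T L l Cl Cu Vb V p) (i : ℤ) : 0 ≤ p.u i := by
  by_cases h : i ∈ Icc 2 T
  · rcases hp.u_binary i h with h | h <;> simp [h]
  · rw [Point.u_eq_zero]
    simp only [mem_Icc] at h; omega

/-- The minimum-up-time inequality, which is imposed from time `L + 1` on, holds at earlier times as
well: the start-up constraint carries it backwards from time `L + 1`. -/
lemma sum_u_le_y (hp : Feasible T L l Cl Cu Vb V p) (hTL : L + 1 ≤ T) {i : ℤ}
    (h1 : 1 ≤ i) (h2 : i ≤ T) : ∑ j ∈ Icc (i - L + 1) i, p.u j ≤ p.y i := by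
  by_cases hi : L + 1 ≤ i
  · exact hp.min_up i (by simp [*])
  have key : ∀ n, n ≤ L + 1 → 1 ≤ n → ∑ j ∈ Icc (n - L + 1) n, p.u j ≤ p.y n := by
    intro n hn
    refine Int.leInductionDown (motive := fun n _ => 1 ≤ n →
      ∑ j ∈ Icc (n - L + 1) n, p.u j ≤ p.y n) ?_ ?_ n hn
    · intro _
      exact hp.min_up (L + 1) (by simp [hTL])
    · intro n hn ih h1
      have ih := ih (by omega)
      have hs := hp.start_up n (by simp only [mem_Icc]; omega)
      have e1 : ∑ j ∈ Icc (n - 1 - L + 1) (n - 1), p.u j = ∑ j ∈ Icc (n - L + 1) (n - 1), p.u j := by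
        symm
        apply Finset.sum_subset
        · intro j; simp only [mem_Icc]; omega
        · intro j; simp only [mem_Icc]; intro h1 h2
          exact Point.u_eq_zero (by omega)
      have e2 : ∑ j ∈ Icc (n - L + 1) n, p.u j = p.u n + ∑ j ∈ Icc (n - L + 1) (n - 1), p.u j := by
        have : Icc (n - L + 1) n = insert n (Icc (n - L + 1) (n - 1)) := by
          ext j; simp only [mem_Icc, mem_insert]; omega
        rw [this, sum_insert (by simp)]
      linarith
  exact key i (by omega) h1

lemma settled_nonneg (hp : Feasible T L l Cl Cu Vb V p) (hTL : L + 1 ≤ T) {i : ℤ}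
    (h1 : 1 ≤ i) (h2 : i ≤ T) : 0 ≤ settled L p i := by
  have := hp.sum_u_le_y hTL h1 h2
  rw [settled, sum_window]; linarith

lemma u_le_y (hp : Feasible T L l Cl Cu Vb V p) (hTL : L + 1 ≤ T) {i j : ℤ}
    (h1 : 1 ≤ i) (h2 : i ≤ T) (hj : j ≤ i) (hj' : i ≤ j + L - 1) : p.u j ≤ p.y i :=
  (single_le_sum (f := fun j => p.u j) (fun j _ => hp.u_nonneg j)
    (by simp only [mem_Icc]; omega)).trans (hp.sum_u_le_y hTL h1 h2)

/-- The counterpart of `sum_u_le_y` at the end of the horizon for the minimum-down-time. -/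
lemma y_add_sum_u_le (hp : Feasible T L l Cl Cu Vb V p) (hTl : l + 1 ≤ T) {i : ℤ}
    (h1 : T - l ≤ i) (h2 : i ≤ T) : p.y i + ∑ j ∈ Icc (i + 1) T, p.u j ≤ 1 := by
  revert h2
  refine Int.leInduction (motive := fun i _ => i ≤ T → p.y i + ∑ j ∈ Icc (i + 1) T, p.u j ≤ 1)
    ?_ ?_ i h1
  · intro _
    have := hp.min_down T (by simp only [mem_Icc]; omega)
    linarith
  · intro n hn ih h2
    have ih := ih (by omega)
    have hs := hp.start_up (n + 1) (by simp only [mem_Icc]; omega)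
    have e2 : ∑ j ∈ Icc (n + 1) T, p.u j = p.u (n + 1) + ∑ j ∈ Icc (n + 1 + 1) T, p.u j := by
      have : Icc (n + 1) T = insert (n + 1) (Icc (n + 1 + 1) T) := by
        ext j; simp only [mem_Icc, mem_insert]; omega
      rw [this, sum_insert (by simp)]
    rw [add_sub_cancel_right] at hs
    linarith

lemma u_le_one_sub_y (hp : Feasible T L l Cl Cu Vb V p) (hl : 1 ≤ l) (hTl : l + 1 ≤ T) {i : ℤ}
    (h1 : 2 ≤ i) (h2 : i ≤ T) : p.u i ≤ 1 - p.y (i - 1) := by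
  by_cases hi : i - 1 + l ≤ T
  · have h := hp.min_down (i - 1 + l) (by simp only [mem_Icc]; omega)
    rw [add_sub_cancel_right] at h
    exact (single_le_sum (f := fun j => p.u j) (fun j _ => hp.u_nonneg j)
      (by simp only [mem_Icc]; omega)).trans h
  · have h := hp.y_add_sum_u_le hTl (i := i - 1) (by omega) (by omega)
    have h' := single_le_sum (s := Icc (i - 1 + 1) T) (f := fun j => p.u j)
      (fun j _ => hp.u_nonneg j) (a := i) (by simp only [mem_Icc]; omega)
    linarith

lemma settled_eq_one (hp : Feasible T L l Cl Cu Vb V p) (hl : 1 ≤ l) (hTl : l + 1 ≤ T) {s i : ℤ}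
    (hiT : i ≤ T) (hsi : s ≤ i) (hy : ∀ j, s ≤ j → j ≤ i → p.y j = 1)
    (ha : s = 1 ∨ s + L ≤ i) : settled L p i = 1 := by
  rw [settled, hy i hsi le_rfl, sum_window, sum_eq_zero, sub_zero]
  intro j hj
  simp only [mem_Icc] at hj
  by_cases h2 : 2 ≤ j
  · have := hp.u_le_one_sub_y hl hTl h2 (by omega)
    rw [hy (j - 1) (by omega) (by omega)] at this
    linarith [hp.u_nonneg j]
  · exact Point.u_eq_zero (by omega)

/-- Ramping down to the shut-down at time `r` bounds the generation at time `t`. -/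
lemma x_le_of_shutdown (hp : Feasible T L l Cl Cu Vb V p) {t r : ℤ} (ht : 1 ≤ t) (htr : t < r)
    (hr : r ≤ T) (hy : ∀ j, t ≤ j → j < r → p.y j = 1) (hyr : p.y r = 0) :
    p.x t ≤ Vb + V * (r - 1 - t) := by
  have key : ∀ n, t ≤ n → n < r → p.x t ≤ p.x n + V * (n - t) := by
    intro n hn
    refine Int.leInduction (motive := fun n _ => n < r → p.x t ≤ p.x n + V * (n - t)) ?_ ?_ n hn
    · intro _; simp
    · intro n hn ih h
      have ih := ih (by omega)
      have h1 := hp.ramp_down (n + 1) (by simp only [mem_Icc]; omega)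
      rw [hy (n + 1) (by omega) h, add_sub_cancel_right] at h1
      push_cast
      linarith
  have h1 := key (r - 1) (by omega) (by omega)
  have h2 := hp.ramp_down r (by simp only [mem_Icc]; omega)
  have h3 := hp.upper_bound r (by simp only [mem_Icc]; omega)
  rw [hyr] at h2 h3
  push_cast at h1
  linarith

/-- Ramping up from the start-up at time `s` bounds the generation at time `t`. -/
lemma x_le_of_startup (hp : Feasible T L l Cl Cu Vb V p) {t s : ℤ} (ht : t ≤ T) (hst : s ≤ t)
    (hs : 2 ≤ s) (hy : ∀ j, s ≤ j → j ≤ t → p.y j = 1) (hys : p.y (s - 1) = 0) :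
    p.x t ≤ Vb + V * (t - s) := by
  have key : ∀ n, s ≤ n → n ≤ t → p.x n ≤ Vb + V * (n - s) := by
    intro n hn
    refine Int.leInduction (motive := fun n _ => n ≤ t → p.x n ≤ Vb + V * (n - s)) ?_ ?_ n hn
    · intro _
      have h2 := hp.ramp_up s (by simp only [mem_Icc]; omega)
      have h3 := hp.upper_bound (s - 1) (by simp only [mem_Icc]; omega)
      rw [hys] at h2 h3
      linarith
    · intro n hn ih h
      have ih := ih (by omega)
      have h1 := hp.ramp_up (n + 1) (by simp only [mem_Icc]; omega)
      rw [add_sub_cancel_right, hy n (by omega) (by omega)] at h1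
      push_cast
      linarith
  exact key t hst le_rfl

end Feasible

/-- The maximal run of `P` from `t` on, within `[t, N]`, ends just before `r`. -/
lemma exists_run_end (P : ℤ → Prop) {t N : ℤ} (h : t ≤ N) (hP : P t) :
    ∃ r, t < r ∧ r ≤ N + 1 ∧ (∀ j, t ≤ j → j < r → P j) ∧ (r ≤ N → ¬ P r) := by
  refine Int.leInduction (motive := fun N _ => ∃ r, t < r ∧ r ≤ N + 1 ∧
    (∀ j, t ≤ j → j < r → P j) ∧ (r ≤ N → ¬ P r)) ?_ ?_ N h
  · refine ⟨t + 1, by omega, by omega, fun j h1 h2 => ?_, by omega⟩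
    obtain rfl : j = t := by omega
    exact hP
  · rintro N hN ⟨r, h1, h2, h3, h4⟩
    by_cases hr : r ≤ N
    · exact ⟨r, h1, by omega, h3, fun _ => h4 hr⟩
    obtain rfl : r = N + 1 := by omega
    by_cases hPN : P (N + 1)
    · refine ⟨N + 1 + 1, by omega, by omega, fun j h5 h6 => ?_, by omega⟩
      rcases eq_or_ne j (N + 1) with rfl | hne
      · exact hPN
      · exact h3 j h5 (by omega)
    · exact ⟨N + 1, h1, by omega, h3, fun _ => hPN⟩

/-- The maximal run of `P` up to `t`, within `[N, t]`, starts at `s`. -/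
lemma exists_run_start (P : ℤ → Prop) {t N : ℤ} (h : N ≤ t) (hP : P t) :
    ∃ s, s ≤ t ∧ N ≤ s ∧ (∀ j, s ≤ j → j ≤ t → P j) ∧ (N < s → ¬ P (s - 1)) := by
  obtain ⟨r, h1, h2, h3, h4⟩ := exists_run_end (fun j => P (-j)) (t := -t) (N := -N) (by omega)
    (by simpa using hP)
  refine ⟨1 - r, by omega, by omega, fun j h5 h6 => ?_, fun h => ?_⟩
  · simpa using h3 (-j) (by omega) (by omega)
  · have := h4 (by omega)
    rwa [show -r = 1 - r - 1 by ring] at this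

/-! ### The index gaps `d_i - i` telescope -/

lemma lt_nextIdx {S : Finset ℤ} {e i : ℤ} (h : i < e) : i < nextIdx S e i := by
  have hne : {a ∈ insert e S | i < a}.Nonempty := ⟨e, by simp [h]⟩
  rw [nextIdx, dif_pos hne]
  have := min'_mem _ hne
  simp only [mem_filter] at this
  exact this.2

lemma nextIdx_eq_of_mem {S : Finset ℤ} {e i : ℤ} (h : i + 1 ∈ insert e S) :
    nextIdx S e i = i + 1 := by
  have hm : i + 1 ∈ {a ∈ insert e S | i < a} := by simp only [mem_filter]; exact ⟨h, by omega⟩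
  rw [nextIdx, dif_pos ⟨_, hm⟩]
  apply le_antisymm (min'_le _ _ hm)
  apply le_min'
  intro a ha
  simp only [mem_filter] at ha
  omega

lemma nextIdx_eq_of_notMem {S : Finset ℤ} {e i : ℤ} (h : i + 1 ∉ insert e S) :
    nextIdx S e i = nextIdx S e (i + 1) := by
  have : {a ∈ insert e S | i < a} = {a ∈ insert e S | i + 1 < a} := by
    apply filter_congr
    intro a ha
    have : a ≠ i + 1 := fun h' => h (h' ▸ ha)
    omega
  simp only [nextIdx, this]

lemma nextIdx_self_nonneg {S : Finset ℤ} {e i : ℤ} (h : i ≤ e) : 0 ≤ nextIdx S e i - i := by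
  unfold nextIdx
  split_ifs with hne
  · have := min'_mem _ hne
    simp only [mem_filter] at this
    omega
  · omega

/-- The gaps of the elements of `{c} ∪ S` below `r` add up to the distance from `c` to the first
element of `S ∪ {e}` that is at least `r`. -/
lemma sum_nextIdx_sub {S : Finset ℤ} {c e r : ℤ} (hS : S ⊆ Icc (c + 1) (e - 1)) (hr : c < r)
    (hre : r ≤ e) :
    ∑ i ∈ insert c S with i < r, (nextIdx S e i - i) = nextIdx S e (r - 1) - c := by
  revert hre
  refine Int.leInduction (m := c + 1) (motive := fun r _ => r ≤ e →
    ∑ i ∈ insert c S with i < r, (nextIdx S e i - i) = nextIdx S e (r - 1) - c) ?_ ?_ r hr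
  · intro _
    have : {i ∈ insert c S | i < c + 1} = {c} := by
      ext i
      simp only [mem_filter, mem_insert, mem_singleton]
      constructor
      · rintro ⟨rfl | h, h'⟩
        · rfl
        · have := mem_Icc.1 (hS h); omega
      · rintro rfl; simp
    rw [this, sum_singleton, add_sub_cancel_right]
  · intro r hr ih hre
    have ih := ih (by omega)
    by_cases hrS : r ∈ S
    · have : {i ∈ insert c S | i < r + 1} = insert r {i ∈ insert c S | i < r} := by
        ext i
        simp only [mem_filter, mem_insert]
        constructor
        · rintro ⟨h, h'⟩
          rcases eq_or_ne i r with h0 | h0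
          · exact Or.inl h0
          · exact Or.inr ⟨h, by omega⟩
        · rintro (rfl | ⟨h, h'⟩)
          · exact ⟨Or.inr hrS, by omega⟩
          · exact ⟨h, by omega⟩
      rw [this, sum_insert (by simp), ih, nextIdx_eq_of_mem (i := r - 1) (by simp [hrS]),
        add_sub_cancel_right]
      ring
    · have h1 : {i ∈ insert c S | i < r + 1} = {i ∈ insert c S | i < r} := by
        apply filter_congr
        intro i hi
        have : i ≠ r := by
          rintro rfl
          rcases mem_insert.1 hi with h | h
          · omega
          · exact hrS h
        omega
      have h2 : r - 1 + 1 ∉ insert e S := by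
        simp only [sub_add_cancel, mem_insert, not_or]
        exact ⟨by omega, hrS⟩
      rw [h1, ih, nextIdx_eq_of_notMem h2, sub_add_cancel, add_sub_cancel_right]

/-- All gaps together add up to `e - c`; this includes `c = e`, where the gap of `c` is `0`. -/
lemma sum_nextIdx_sub_all {S : Finset ℤ} {c e : ℤ} (hS : S ⊆ Icc (c + 1) (e - 1)) (hce : c ≤ e) :
    ∑ i ∈ insert c S, (nextIdx S e i - i) = e - c := by
  rcases hce.lt_or_eq with h | rfl
  · have h1 := sum_nextIdx_sub hS h le_rfl
    rw [nextIdx_eq_of_mem (i := e - 1) (by simp), sub_add_cancel, filter_true_of_mem] at h1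
    · exact h1
    · intro i hi
      rcases mem_insert.1 hi with rfl | hi
      · exact h
      · have := mem_Icc.1 (hS hi); omega
  · have : S = ∅ := by
      rw [← subset_empty]
      refine hS.trans (by simp)
    subst this
    have h : nextIdx ∅ c c = c := by
      rw [nextIdx, dif_neg]
      simp
    simp [h]

/-! ### Validity -/

lemma le_tHat (L t : ℤ) (hL : 1 ≤ L) : t < tHat L t := by
  unfold tHat
  split_ifs <;> omega

/-- A lower bound for the contribution of the periods after `t` to the right-hand side, for a status
`w` that is settled on `[a, r - 1]`. Here `c` stands for `t̂` and `e` for `t + m + 1`. -/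
lemma sum_settled_ge {w : ℤ → ℝ} {V D : ℝ} {S : Finset ℤ} {t c e T a r : ℤ} (hV : 0 ≤ V)
    (hD : 0 ≤ D) (hS : S ⊆ Icc (c + 1) (e - 1)) (htc : t < c) (hce : c ≤ e) (heT : e ≤ T)
    (hw : ∀ i, t < i → i ≤ T → 0 ≤ w i) (hta : t < a) (hac : a ≤ c) (har : a ≤ r)
    (hw1 : ∀ i, a ≤ i → i < r → i ≤ T → 1 ≤ w i) :
    (r ≤ e → V * (r - a) ≤ V * ∑ i ∈ Icc (t + 1) (c - 1), w i +
      V * ∑ i ∈ insert c S, ((nextIdx S e i - i : ℤ) : ℝ) * w i + D * w e) ∧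
    (e < r → V * (e - a) + D ≤ V * ∑ i ∈ Icc (t + 1) (c - 1), w i +
      V * ∑ i ∈ insert c S, ((nextIdx S e i - i : ℤ) : ℝ) * w i + D * w e) := by
  have hmem : ∀ i ∈ insert c S, c ≤ i ∧ i ≤ e := by
    intro i hi
    rcases mem_insert.1 hi with rfl | hi
    · exact ⟨le_rfl, hce⟩
    · have := mem_Icc.1 (hS hi); omega
  have h1 : ((min r c - a : ℤ) : ℝ) ≤ ∑ i ∈ Icc (t + 1) (c - 1), w i := by
    calc ((min r c - a : ℤ) : ℝ) = ∑ i ∈ Ico a (min r c), (1 : ℝ) := by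
          rw [sum_const, Int.card_Ico, nsmul_eq_mul, mul_one]
          exact_mod_cast (Int.toNat_of_nonneg (by omega)).symm
      _ ≤ ∑ i ∈ Ico a (min r c), w i := by
          apply sum_le_sum
          intro i hi
          simp only [mem_Ico] at hi
          exact hw1 i (by omega) (by omega) (by omega)
      _ ≤ _ := by
          apply sum_le_sum_of_subset_of_nonneg
          · intro i; simp only [mem_Ico, mem_Icc]; omega
          · intro i hi _
            simp only [mem_Icc] at hi
            exact hw i (by omega) (by omega)
  have hterm : ∀ i ∈ insert c S, 0 ≤ ((nextIdx S e i - i : ℤ) : ℝ) * w i := by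
    intro i hi
    have := hmem i hi
    exact mul_nonneg (by exact_mod_cast nextIdx_self_nonneg this.2) (hw i (by omega) (by omega))
  have h2 : ((∑ i ∈ insert c S with i < r, (nextIdx S e i - i) : ℤ) : ℝ) ≤
      ∑ i ∈ insert c S, ((nextIdx S e i - i : ℤ) : ℝ) * w i := by
    rw [Int.cast_sum]
    refine le_trans (sum_le_sum (g := fun i => ((nextIdx S e i - i : ℤ) : ℝ) * w i) ?_)
      (sum_le_sum_of_subset_of_nonneg (filter_subset _ _) fun i hi _ => hterm i hi)
    intro i hi
    rw [mem_filter] at hi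
    have := hmem i hi.1
    exact le_mul_of_one_le_right (by exact_mod_cast nextIdx_self_nonneg this.2)
      (hw1 i (by omega) hi.2 (by omega))
  have h3 : 0 ≤ D * w e := mul_nonneg hD (hw e (by omega) heT)
  constructor
  · intro hre
    by_cases hrc : r ≤ c
    · have h4 : 0 ≤ ∑ i ∈ insert c S, ((nextIdx S e i - i : ℤ) : ℝ) * w i := sum_nonneg hterm
      rw [min_eq_left hrc] at h1
      push_cast at h1
      have := mul_le_mul_of_nonneg_left h1 hV
      have := mul_nonneg hV h4
      linarith
    · rw [sum_nextIdx_sub hS (by omega) hre] at h2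
      rw [min_eq_right (by omega)] at h1
      have h5 : (r : ℝ) ≤ nextIdx S e (r - 1) := by
        have := lt_nextIdx (S := S) (show r - 1 < e by omega)
        exact_mod_cast (by omega : r ≤ nextIdx S e (r - 1))
      push_cast at h1 h2
      have h6 := mul_le_mul_of_nonneg_left (show (r - a : ℝ) ≤ ∑ i ∈ Icc (t + 1) (c - 1), w i +
        ∑ i ∈ insert c S, ((nextIdx S e i - i : ℤ) : ℝ) * w i by push_cast; linarith) hV
      rw [mul_add] at h6
      linarith
  · intro her
    rw [filter_true_of_mem (fun i hi => (hmem i hi).2.trans_lt her),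
      sum_nextIdx_sub_all hS hce] at h2
    rw [min_eq_right (by omega)] at h1
    push_cast at h1 h2
    have h6 := mul_le_mul_of_nonneg_left (show (e - a : ℝ) ≤ ∑ i ∈ Icc (t + 1) (c - 1), w i +
      ∑ i ∈ insert c S, ((nextIdx S e i - i : ℤ) : ℝ) * w i by push_cast; linarith) hV
    rw [mul_add] at h6
    have := le_mul_of_one_le_right hD (hw1 e (by omega) her heT)
    linarith

section Validity

variable {T L l : ℤ} {Cl Cu Vb V : ℝ} {p : Point T}

lemma Feasible.phi_nonneg (hp : Feasible T L l Cl Cu Vb V p) (hV : 0 ≤ V) (t : ℤ) :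
    0 ≤ phi L V t p := by
  refine add_nonneg (mul_nonneg hV (sum_nonneg fun k hk => mul_nonneg ?_ (hp.u_nonneg _)))
    (mul_nonneg hV (sum_nonneg fun k hk => mul_nonneg ?_ (hp.u_nonneg _)))
  · rw [mem_Icc] at hk
    exact_mod_cast (by omega : 0 ≤ k)
  · rw [mem_Icc] at hk
    exact_mod_cast (by omega : 0 ≤ min (L - 1 - k) k)

lemma Feasible.le_phi_of_late (hp : Feasible T L l Cl Cu Vb V p) (hV : 0 ≤ V) {t k : ℤ}
    (hu : p.u (t - k) = 1) (hk : 1 ≤ k) (hk' : k ≤ t + L - T - 1) : V * k ≤ phi L V t p := by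
  have h1 : (k : ℝ) ≤ ∑ k ∈ Icc 1 (t + L - T - 1), (k : ℝ) * p.u (t - k) := by
    have := single_le_sum (f := fun k : ℤ => (k : ℝ) * p.u (t - k)) (s := Icc 1 (t + L - T - 1))
      (a := k) (fun j hj => ?_) (by simp [*])
    · simpa [hu] using this
    · rw [mem_Icc] at hj
      exact mul_nonneg (by exact_mod_cast (by omega : 0 ≤ j)) (hp.u_nonneg _)
  refine (mul_le_mul_of_nonneg_left h1 hV).trans (le_add_of_nonneg_right ?_)
  refine mul_nonneg hV (sum_nonneg fun k hk => mul_nonneg ?_ (hp.u_nonneg _))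
  rw [mem_Icc] at hk
  exact_mod_cast (by omega : 0 ≤ min (L - 1 - k) k)

lemma Feasible.le_phi_of_early (hp : Feasible T L l Cl Cu Vb V p) (hV : 0 ≤ V) {t k : ℤ}
    (hu : p.u (t - k) = 1) (hk : max (t + L - T) 0 ≤ k) (hk' : k ≤ min (L - 1) (t - 2)) :
    V * (min (L - 1 - k) k : ℤ) ≤ phi L V t p := by
  have h1 : ((min (L - 1 - k) k : ℤ) : ℝ) ≤ ∑ k ∈ Icc (max (t + L - T) 0) (min (L - 1) (t - 2)),
      ((min (L - 1 - k) k : ℤ) : ℝ) * p.u (t - k) := by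
    have := single_le_sum (f := fun k : ℤ => ((min (L - 1 - k) k : ℤ) : ℝ) * p.u (t - k))
      (s := Icc (max (t + L - T) 0) (min (L - 1) (t - 2)))
      (a := k) (fun j hj => ?_) (by rw [mem_Icc]; exact ⟨hk, hk'⟩)
    · simpa only [hu, mul_one] using this
    · rw [mem_Icc] at hj
      exact mul_nonneg (by exact_mod_cast (by omega : 0 ≤ min (L - 1 - j) j)) (hp.u_nonneg _)
  refine (mul_le_mul_of_nonneg_left h1 hV).trans (le_add_of_nonneg_left ?_)
  refine mul_nonneg hV (sum_nonneg fun k hk => mul_nonneg ?_ (hp.u_nonneg _))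
  rw [mem_Icc] at hk
  exact_mod_cast (by omega : 0 ≤ k)

theorem Feasible.x_le_rhs (hp : Feasible T L l Cl Cu Vb V p)
    (hL : 1 ≤ L) (hl : 1 ≤ l) (hTL : L + 1 ≤ T) (hTl : l + 1 ≤ T)
    (hV : 0 < V) {t m : ℤ} (ht : 1 ≤ t)
    (hm_lower : tHat L t - t - 1 ≤ m)
    (hm_upper : m ≤ T - t - 1) (hm_cap : (m : ℝ) * V ≤ Cu - Vb)
    {S : Finset ℤ} (hS : S ⊆ Icc (tHat L t + 1) (t + m)) :
    p.x t ≤ rhs L Cu Vb V t m S p := by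
  have htc := le_tHat L t hL
  have hS' : S ⊆ Icc (tHat L t + 1) (t + m + 1 - 1) := by rwa [add_sub_cancel_right]
  have hw : ∀ i, t < i → i ≤ T → 0 ≤ settled L p i := fun i h1 h2 =>
    hp.settled_nonneg hTL (by omega) h2
  have hphi := hp.phi_nonneg hV.le t
  have hD : 0 ≤ Cu - Vb - m * V := by linarith
  rw [rhs_eq_settled]
  have hub := hp.upper_bound t (by simp only [mem_Icc]; omega)
  have hrest := (sum_settled_ge (a := t + 1) (r := t + 1) hV.le hD hS' htc (by omega) (by omega) hw
    (by omega) (by omega) le_rfl (by omega)).1 (by omega)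
  rw [sub_self, mul_zero] at hrest
  rcases hp.y_binary t (by simp only [mem_Icc]; omega) with hyt | hyt
  · rw [hyt] at hub ⊢
    linarith
  obtain ⟨r, htr, hrT, hyr, hr⟩ := exists_run_end (fun j => p.y j = 1) (show t ≤ T by omega) hyt
  obtain ⟨s, hst, hs, hys, hs'⟩ := exists_run_start (fun j => p.y j = 1) ht hyt
  have hrun : ∀ j, s ≤ j → j < r → p.y j = 1 := fun j h1 h2 =>
    if h : t ≤ j then hyr j h h2 else hys j h1 (by omega)
  have hyr0 : r ≤ T → p.y r = 0 := fun h =>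
    (hp.y_binary r (by simp only [mem_Icc]; omega)).resolve_right (hr h)
  -- If the settled periods of the run after `t` start at `a` and `φ` pays for those before `a`, then
  -- the right-hand side is at least the ramp-down bound or the capacity.
  have finish : ∀ a, t < a → a ≤ tHat L t → a ≤ r → (s = 1 ∨ s + L ≤ a) →
      V * (a - 1 - t) ≤ phi L V t p →
      p.x t ≤ Vb * p.y t + V * ∑ i ∈ Icc (t + 1) (tHat L t - 1), settled L p i +
      V * ∑ i ∈ insert (tHat L t) S, ((nextIdx S (t + m + 1) i - i : ℤ) : ℝ) * settled L p i +
      (Cu - Vb - m * V) * settled L p (t + m + 1) + phi L V t p := by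
    intro a h1 h2 h3 h4 h5
    have key := sum_settled_ge (a := a) (r := r) hV.le hD hS' htc (by omega) (by omega) hw
      h1 h2 h3 (fun i h6 h7 h8 => (hp.settled_eq_one hl hTl h8 (by omega)
        (fun j h9 h10 => hrun j h9 (by omega)) (by omega)).ge)
    rw [hyt] at hub ⊢
    by_cases hre : r ≤ t + m + 1
    · have k1 := key.1 hre
      have k2 := hp.x_le_of_shutdown ht htr (by omega) hyr (hyr0 (by omega))
      linarith
    · have k1 := key.2 (by omega)
      simp only [Int.cast_add, Int.cast_one] at k1
      linarith
  by_cases hcase : s = 1 ∨ s + L ≤ t + 1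
  · exact finish (t + 1) (by omega) (by omega) (by omega) hcase (by simpa using hphi)
  have hs2 : 2 ≤ s := by omega
  have hys0 : p.y (s - 1) = 0 :=
    (hp.y_binary (s - 1) (by simp only [mem_Icc]; omega)).resolve_right (hs' (by omega))
  have hus : p.u s = 1 := by
    have h1 := hp.start_up s (by simp only [mem_Icc]; omega)
    rw [hys s le_rfl hst, hys0] at h1
    rcases hp.u_binary s (by simp only [mem_Icc]; omega) with h | h
    · rw [h] at h1; norm_num at h1
    · exact h
  have hu : p.u (t - (t - s)) = 1 := by rwa [sub_sub_cancel]
  have hup := hp.x_le_of_startup (by omega) hst hs2 hys hys0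
  -- If `φ` pays for all periods since the start-up, the ramp-up bound is enough.
  have easy : V * (t - s : ℤ) ≤ phi L V t p →
      p.x t ≤ Vb * p.y t + V * ∑ i ∈ Icc (t + 1) (tHat L t - 1), settled L p i +
      V * ∑ i ∈ insert (tHat L t) S, ((nextIdx S (t + m + 1) i - i : ℤ) : ℝ) * settled L p i +
      (Cu - Vb - m * V) * settled L p (t + m + 1) + phi L V t p := by
    intro h
    push_cast at h
    rw [hyt]
    linarith
  by_cases h1 : t - s ≤ t + L - T - 1
  · apply easy
    by_cases h2 : 1 ≤ t - s
    · exact hp.le_phi_of_late hV.le hu h2 h1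
    · obtain rfl : s = t := by omega
      simpa using hphi
  have hearly := hp.le_phi_of_early hV.le hu (by omega) (by omega)
  by_cases h2 : t - s ≤ L - 1 - (t - s)
  · rw [min_eq_right h2] at hearly
    exact easy hearly
  · rw [min_eq_left (by omega)] at hearly
    refine finish (s + L) (by omega) ?_ ?_ (Or.inr le_rfl) ?_
    · unfold tHat
      split_ifs <;> omega
    · by_contra hlt
      have := hp.u_le_y hTL (i := r) (j := s) (by omega) (by omega) (by omega) (by omega)
      rw [hus, hyr0 (by omega)] at this
      norm_num at this
    · push_cast at hearly ⊢
      linarith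

end Validity

/-! ### Single-run points -/

/-- The point whose coordinates are the values of `f`, `g`, `h` at the respective indices. -/
def ofFun {T : ℤ} (f g h : ℤ → ℝ) : Point T := (fun i => f i, fun i => g i, fun i => h i)

/-- The status sequence of a unit that is online exactly during `[a, b]`. -/
noncomputable def onSeq (a b : ℤ) (i : ℤ) : ℝ := if a ≤ i ∧ i ≤ b then 1 else 0

/-- Generation of a unit that is online exactly during `[a, b]`: as small as `Vb` and the ramp rate
allow, subject to reaching `c` at time `t`. -/
noncomputable def tentSeq (Vb V c : ℝ) (t a b : ℤ) (i : ℤ) : ℝ :=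
  if a ≤ i ∧ i ≤ b then max Vb (c - V * |(i : ℝ) - t|) else 0

/-- The point that is online exactly during `[a, b]`, with generation `tentSeq`. For `a = 1` there is
no start-up, since `1` is not an index of `u`. -/
noncomputable def runPoint {T : ℤ} (Vb V c : ℝ) (t a b : ℤ) : Point T :=
  ofFun (tentSeq Vb V c t a b) (onSeq a b) (Pi.single a 1)

section RunPoint

variable {T : ℤ}

lemma ofFun_x {f g h : ℤ → ℝ} {i : ℤ} (h1 : 1 ≤ i) (h2 : i ≤ T) :
    (ofFun f g h : Point T).x i = f i := by
  rw [Point.x, dif_pos (by simp [*])]; rfl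

lemma ofFun_y {f g h : ℤ → ℝ} {i : ℤ} (h1 : 1 ≤ i) (h2 : i ≤ T) :
    (ofFun f g h : Point T).y i = g i := by
  rw [Point.y, dif_pos (by simp [*])]; rfl

lemma ofFun_u {f g h : ℤ → ℝ} {i : ℤ} (h1 : 2 ≤ i) (h2 : i ≤ T) :
    (ofFun f g h : Point T).u i = h i := by
  rw [Point.u, dif_pos (by simp [*])]; rfl

lemma ofFun_sub {f g h f' g' h' : ℤ → ℝ} :
    (ofFun f g h : Point T) - ofFun f' g' h' = ofFun (f - f') (g - g') (h - h') := rfl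

lemma ofFun_single_u {f g : ℤ → ℝ} {a : ℤ} (h1 : 2 ≤ a) (h2 : a ≤ T) (i : ℤ) :
    (ofFun f g (Pi.single a 1) : Point T).u i = if i = a then 1 else 0 := by
  by_cases hi : 2 ≤ i ∧ i ≤ T
  · rw [ofFun_u hi.1 hi.2, Pi.single_apply]
  · rw [Point.u_eq_zero (by omega), if_neg (by omega)]

lemma ofFun_single_one_u {f g : ℤ → ℝ} (i : ℤ) :
    (ofFun f g (Pi.single 1 1) : Point T).u i = 0 := by
  by_cases hi : 2 ≤ i ∧ i ≤ T
  · rw [ofFun_u hi.1 hi.2, Pi.single_apply, if_neg (by omega)]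
  · rw [Point.u_eq_zero (by omega)]

lemma tent_lipschitz {Vb V c : ℝ} (hV : 0 ≤ V) (t i j : ℝ) (hij : |i - j| ≤ 1) :
    max Vb (c - V * |i - t|) - max Vb (c - V * |j - t|) ≤ V := by
  have h1 : |j - t| ≤ |i - t| + 1 := by
    have := abs_sub_le j i t
    rw [abs_sub_comm j i] at this
    linarith
  have h2 := mul_le_mul_of_nonneg_left h1 hV
  have h3 : max Vb (c - V * |i - t|) ≤ max Vb (c - V * |j - t|) + V := by
    apply max_le
    · linarith [le_max_left Vb (c - V * |j - t|)]
    · linarith [le_max_right Vb (c - V * |j - t|)]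
  linarith

/-- The run may be short only if it touches an end of the horizon, and `c` must be low enough for the
generation to be `Vb` next to a start-up or shut-down. -/
lemma runPoint_feasible {L l : ℤ} {Cl Cu Vb V c : ℝ} {t a b : ℤ} (hl : 1 ≤ l)
    (hCl : 0 ≤ Cl) (hClVb : Cl ≤ Vb) (hV : 0 ≤ V) (ha : 1 ≤ a) (hbT : b ≤ T) (haT : a ≤ T)
    (hab : a = 1 ∨ b = T ∨ a + L - 1 ≤ b) (hc : Vb ≤ c) (hcu : c ≤ Cu)
    (hca : 2 ≤ a → c - V * |(a : ℝ) - t| ≤ Vb) (hcb : b < T → c - V * |(b : ℝ) - t| ≤ Vb) :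
    Feasible T L l Cl Cu Vb V (runPoint Vb V c t a b) := by
  have hxl : ∀ i : ℤ, Vb ≤ max Vb (c - V * |(i : ℝ) - t|) := fun i => le_max_left _ _
  have hxu : ∀ i : ℤ, max Vb (c - V * |(i : ℝ) - t|) ≤ Cu := fun i =>
    max_le (hc.trans hcu) (by linarith [mul_nonneg hV (abs_nonneg ((i : ℝ) - t))])
  have hx : ∀ i, 1 ≤ i → i ≤ T →
      (runPoint Vb V c t a b : Point T).x i = tentSeq Vb V c t a b i := fun i => ofFun_x
  have hy : ∀ i, 1 ≤ i → i ≤ T → (runPoint Vb V c t a b : Point T).y i = onSeq a b i :=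
    fun i => ofFun_y
  have hu : ∀ i, 2 ≤ i → i ≤ T →
      (runPoint Vb V c t a b : Point T).u i = if i = a then 1 else 0 := fun i h1 h2 => by
    rw [runPoint, ofFun_u h1 h2, Pi.single_apply]
  have hsum : ∀ s i, i ≤ T → ∑ j ∈ Icc s i, (runPoint Vb V c t a b : Point T).u j =
      if 2 ≤ a ∧ s ≤ a ∧ a ≤ i then 1 else 0 := by
    intro s i hi
    rcases ha.lt_or_eq with h | rfl
    · simp only [runPoint, ofFun_single_u (show 2 ≤ a by omega) haT, sum_ite_eq', mem_Icc]
      exact if_congr (by omega) rfl rfl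
    · simp [runPoint, ofFun_single_one_u]
  constructor
  · intro i hi
    rw [mem_Icc] at hi
    rw [hx i hi.1 hi.2, tentSeq]
    split_ifs <;> linarith [hxl i]
  · intro i hi
    rw [mem_Icc] at hi
    rw [hy i hi.1 hi.2, onSeq]
    split_ifs <;> simp
  · intro i hi
    rw [mem_Icc] at hi
    rw [hu i hi.1 hi.2]
    split_ifs <;> simp
  · intro i hi
    rw [mem_Icc] at hi
    rw [hsum _ _ hi.2]
    by_cases h : 2 ≤ a ∧ i - L + 1 ≤ a ∧ a ≤ i
    · rw [hy i (by omega) hi.2, onSeq, if_pos h, if_pos (by omega)]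
    · rw [if_neg h]
      by_cases hi1 : 1 ≤ i
      · rw [hy i hi1 hi.2, onSeq]
        split_ifs <;> simp
      · rw [Point.y, dif_neg (by simp [hi1])]
  · intro i hi
    rw [mem_Icc] at hi
    rw [hsum _ _ hi.2, hy (i - l) (by omega) (by omega), onSeq]
    split_ifs <;> first | omega | simp
  · intro i hi
    rw [mem_Icc] at hi
    rw [hu i hi.1 hi.2, hy i (by omega) hi.2, hy (i - 1) (by omega) (by omega), onSeq, onSeq]
    split_ifs <;> first | omega | norm_num
  · intro i hi
    rw [mem_Icc] at hi
    rw [hx i hi.1 hi.2, hy i hi.1 hi.2, tentSeq, onSeq]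
    split_ifs <;> linarith [hxl i]
  · intro i hi
    rw [mem_Icc] at hi
    rw [hx i hi.1 hi.2, hy i hi.1 hi.2, tentSeq, onSeq]
    split_ifs <;> linarith [hxu i]
  · intro i hi
    rw [mem_Icc] at hi
    rw [hx i (by omega) hi.2, hx (i - 1) (by omega) (by omega), hy (i - 1) (by omega) (by omega),
      tentSeq, tentSeq, onSeq]
    split_ifs with h1 h2 h2
    · have := tent_lipschitz (Vb := Vb) (c := c) hV t i (i - 1 : ℤ) (by simp)
      linarith
    · obtain rfl : i = a := by omega
      rw [max_eq_left (hca hi.1)]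
      linarith
    · linarith [hxl (i - 1)]
    · linarith
  · intro i hi
    rw [mem_Icc] at hi
    rw [hx i (by omega) hi.2, hx (i - 1) (by omega) (by omega), hy i (by omega) (by omega),
      tentSeq, tentSeq, onSeq]
    split_ifs with h1 h2 h2
    · have := tent_lipschitz (Vb := Vb) (c := c) hV t (i - 1 : ℤ) i (by simp)
      linarith
    · obtain rfl : b = i - 1 := by omega
      rw [max_eq_left (hcb (by omega))]
      linarith
    · linarith [hxl i]
    · linarith

lemma runPoint_x_peak {Vb V c : ℝ} {t a b : ℤ} (ht : 1 ≤ t) (htT : t ≤ T) (hat : a ≤ t)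
    (htb : t ≤ b) (hc : Vb ≤ c) : (runPoint Vb V c t a b : Point T).x t = c := by
  rw [runPoint, ofFun_x ht htT, tentSeq, if_pos ⟨hat, htb⟩]
  simp [hc]

lemma runPoint_x_off {Vb V c : ℝ} {t a b : ℤ} (ht : 1 ≤ t) (htT : t ≤ T) (h : t < a ∨ b < t) :
    (runPoint Vb V c t a b : Point T).x t = 0 := by
  rw [runPoint, ofFun_x ht htT, tentSeq, if_neg (by omega)]

lemma settled_of_u_eq_single {L a b i : ℤ} {f : ℤ → ℝ} (ha : 2 ≤ a) (haT : a ≤ T)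
    (hi : 1 ≤ i) (hiT : i ≤ T) :
    settled L (ofFun f (onSeq a b) (Pi.single a 1) : Point T) i =
      onSeq a b i - if i - L + 1 ≤ a ∧ a ≤ i then 1 else 0 := by
  rw [settled, sum_window, ofFun_y hi hiT]
  simp only [ofFun_single_u ha haT, sum_ite_eq', mem_Icc]

/-- At an initial run that contains `t`, the right-hand side is what the unit can generate at time
`t` when it is switched off after time `b`, provided the first period after the run is one of those in
`[t + 1, t̂] ∪ S ∪ {t + m + 1}`. -/
lemma rhs_initial_run {L t m b : ℤ} {Cu Vb V : ℝ} {S : Finset ℤ} {f : ℤ → ℝ} (ht : 1 ≤ t)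
    (hL : 1 ≤ L) (hm_lower : tHat L t - t - 1 ≤ m) (hm_upper : m ≤ T - t - 1)
    (hS : S ⊆ Icc (tHat L t + 1) (t + m)) (htb : t ≤ b)
    (hb : b + 1 ≤ tHat L t ∨ b + 1 ∈ insert (t + m + 1) S) :
    rhs L Cu Vb V t m S (ofFun f (onSeq 1 b) (Pi.single 1 1) : Point T) = Vb + V * (b - t) := by
  have htc := le_tHat L t hL
  have hS' : S ⊆ Icc (tHat L t + 1) (t + m + 1 - 1) := by rwa [add_sub_cancel_right]
  have hset : ∀ i, 1 ≤ i → i ≤ T → settled L (ofFun f (onSeq 1 b) (Pi.single 1 1) : Point T) i =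
      if i < b + 1 then 1 else 0 := by
    intro i h1 h2
    rw [settled, ofFun_y h1 h2, onSeq]
    simp only [ofFun_single_one_u, sum_const_zero, sub_zero]
    exact if_congr (by omega) rfl rfl
  have hbe : b + 1 ≤ t + m + 1 := by
    rcases hb with h | h
    · omega
    · rcases mem_insert.1 h with h | h
      · omega
      · have := mem_Icc.1 (hS h); omega
  have h1 : ∑ i ∈ Icc (t + 1) (tHat L t - 1),
      settled L (ofFun f (onSeq 1 b) (Pi.single 1 1) : Point T) i =
      ((min (b + 1) (tHat L t) - (t + 1) : ℤ) : ℝ) := by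
    rw [sum_congr rfl (g := fun i => if i < b + 1 then (1 : ℝ) else 0), sum_boole]
    · have : {i ∈ Icc (t + 1) (tHat L t - 1) | i < b + 1} = Ico (t + 1) (min (b + 1) (tHat L t)) := by
        ext i; simp only [mem_filter, mem_Icc, mem_Ico]; omega
      rw [this, Int.card_Ico]
      exact_mod_cast Int.toNat_of_nonneg (by omega)
    · intro i hi
      rw [mem_Icc] at hi
      exact hset i (by omega) (by omega)
  have h2 : ∑ i ∈ insert (tHat L t) S, ((nextIdx S (t + m + 1) i - i : ℤ) : ℝ) *
      settled L (ofFun f (onSeq 1 b) (Pi.single 1 1) : Point T) i =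
      ((∑ i ∈ insert (tHat L t) S with i < b + 1, (nextIdx S (t + m + 1) i - i) : ℤ) : ℝ) := by
    rw [Int.cast_sum, sum_filter]
    apply sum_congr rfl
    intro i hi
    have : 1 ≤ i ∧ i ≤ T := by
      rcases mem_insert.1 hi with rfl | hi
      · omega
      · have := mem_Icc.1 (hS hi); omega
    rw [hset i this.1 this.2]
    split_ifs <;> simp
  have h3 : settled L (ofFun f (onSeq 1 b) (Pi.single 1 1) : Point T) (t + m + 1) = 0 := by
    rw [hset _ (by omega) (by omega), if_neg (by omega)]
  have h4 : phi L V t (ofFun f (onSeq 1 b) (Pi.single 1 1) : Point T) = 0 := by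
    simp [phi, ofFun_single_one_u]
  rw [rhs_eq_settled, h1, h2, h3, h4, ofFun_y ht (by omega), onSeq, if_pos ⟨ht, htb⟩]
  by_cases hbc : b + 1 ≤ tHat L t
  · have h5 : {i ∈ insert (tHat L t) S | i < b + 1} = ∅ := by
      rw [filter_eq_empty_iff]
      intro i hi
      rcases mem_insert.1 hi with rfl | hi
      · omega
      · have := mem_Icc.1 (hS hi); omega
    rw [h5, min_eq_left hbc]
    push_cast
    simp
  · rw [sum_nextIdx_sub hS' (by omega) hbe, nextIdx_eq_of_mem (by
      rw [sub_add_cancel]; exact hb.resolve_left hbc), min_eq_right (by omega)]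
    push_cast
    ring

lemma rhs_always_on {L t m : ℤ} {Cu Vb V : ℝ} {S : Finset ℤ} {f : ℤ → ℝ} (ht : 1 ≤ t)
    (hL : 1 ≤ L) (hm_lower : tHat L t - t - 1 ≤ m) (hm_upper : m ≤ T - t - 1)
    (hS : S ⊆ Icc (tHat L t + 1) (t + m)) :
    rhs L Cu Vb V t m S (ofFun f (onSeq 1 T) (Pi.single 1 1) : Point T) = Cu := by
  have htc := le_tHat L t hL
  have hS' : S ⊆ Icc (tHat L t + 1) (t + m + 1 - 1) := by rwa [add_sub_cancel_right]
  have hset : ∀ i, 1 ≤ i → i ≤ T →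
      settled L (ofFun f (onSeq 1 T) (Pi.single 1 1) : Point T) i = 1 := by
    intro i h1 h2
    rw [settled, ofFun_y h1 h2, onSeq, if_pos ⟨h1, h2⟩]
    simp [ofFun_single_one_u]
  have h1 : ∑ i ∈ Icc (t + 1) (tHat L t - 1),
      settled L (ofFun f (onSeq 1 T) (Pi.single 1 1) : Point T) i = tHat L t - 1 - t := by
    rw [sum_congr rfl (g := fun _ => (1 : ℝ)), sum_const, Int.card_Icc, nsmul_one]
    · have := Int.toNat_of_nonneg (show 0 ≤ tHat L t - 1 + 1 - (t + 1) by omega)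
      have h : ((tHat L t - 1 + 1 - (t + 1)).toNat : ℝ) = ((tHat L t - 1 + 1 - (t + 1) : ℤ) : ℝ) := by
        exact_mod_cast this
      rw [h]; push_cast; ring
    · intro i hi
      rw [mem_Icc] at hi
      exact hset i (by omega) (by omega)
  have h2 : ∑ i ∈ insert (tHat L t) S, ((nextIdx S (t + m + 1) i - i : ℤ) : ℝ) *
      settled L (ofFun f (onSeq 1 T) (Pi.single 1 1) : Point T) i = t + m + 1 - tHat L t := by
    have h := sum_nextIdx_sub_all hS' (by omega)
    have h' : ((∑ i ∈ insert (tHat L t) S, (nextIdx S (t + m + 1) i - i) : ℤ) : ℝ) =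
      ((t + m + 1 - tHat L t : ℤ) : ℝ) := by rw [h]
    rw [Int.cast_sum] at h'
    push_cast at h' ⊢
    rw [← h']
    apply sum_congr rfl
    intro i hi
    have : 1 ≤ i ∧ i ≤ T := by
      rcases mem_insert.1 hi with rfl | hi
      · omega
      · have := mem_Icc.1 (hS hi); omega
    rw [hset i this.1 this.2, mul_one]
  have h4 : phi L V t (ofFun f (onSeq 1 T) (Pi.single 1 1) : Point T) = 0 := by
    simp [phi, ofFun_single_one_u]
  rw [rhs_eq_settled, h1, h2, hset _ (by omega) (by omega), h4, ofFun_y ht (by omega), onSeq,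
    if_pos ⟨ht, by omega⟩]
  ring

/-- If no index of the inequality beyond `t` is settled, only `y_t` and `φ` contribute. -/
lemma rhs_of_settled_eq_zero {L t m : ℤ} {Cu Vb V : ℝ} {S : Finset ℤ} {p : Point T}
    (hm_lower : tHat L t - t - 1 ≤ m)
    (h : ∀ i, t < i → i ≤ t + m + 1 → (i ≤ tHat L t ∨ i ∈ insert (t + m + 1) S) →
      settled L p i = 0) (hL : 1 ≤ L) (hS : S ⊆ Icc (tHat L t + 1) (t + m)) :
    rhs L Cu Vb V t m S p = Vb * p.y t + phi L V t p := by
  have htc := le_tHat L t hL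
  rw [rhs_eq_settled, sum_eq_zero, sum_eq_zero, h (t + m + 1) (by omega) le_rfl (by simp)]
  · ring
  · intro i hi
    rw [h i, mul_zero]
    · rcases mem_insert.1 hi with rfl | hi
      · exact htc
      · have := mem_Icc.1 (hS hi); omega
    · rcases mem_insert.1 hi with rfl | hi
      · omega
      · have := mem_Icc.1 (hS hi); omega
    · rcases mem_insert.1 hi with rfl | hi
      · exact Or.inl le_rfl
      · exact Or.inr (by simp [hi])
  · intro i hi
    rw [mem_Icc] at hi
    exact h i (by omega) (by omega) (Or.inl (by omega))

/-- The coefficient, in units of `V`, of the start-up `u_a` in `φ(u, t)`: the first case is that the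
minimum-up-time lasts to the end of the horizon, so that no shut-down limits the ramp. -/
def phiCoeff (T L t a : ℤ) : ℤ :=
  if a ≤ t ∧ t < a + L ∧ 2 ≤ a then
    if T ≤ a + L - 1 then t - a else min (L - 1 - (t - a)) (t - a)
  else 0

lemma phi_single {L t a : ℤ} {V : ℝ} {f g : ℤ → ℝ} (ha : 2 ≤ a) (haT : a ≤ T) (htT : t < T) :
    phi L V t (ofFun f g (Pi.single a 1) : Point T) = V * phiCoeff T L t a := by
  have h : ∀ k : ℤ, (t - k = a) = (k = t - a) := fun k => propext (by omega)
  simp only [phi, ofFun_single_u ha haT, h, mul_ite, mul_one, mul_zero, sum_ite_eq', mem_Icc,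
    phiCoeff]
  by_cases h1 : a ≤ t ∧ t < a + L ∧ 2 ≤ a
  · rw [if_pos h1]
    by_cases h2 : T ≤ a + L - 1
    · rw [if_pos h2]
      by_cases h3 : t = a
      · subst h3
        simp only [sub_self, min_eq_right (show 0 ≤ L - 1 - 0 by omega)]
        simp
      · rw [if_pos (by omega), if_neg (by omega)]; simp
    · rw [if_neg (by omega), if_pos (by omega), if_neg h2]; simp
  · rw [if_neg (by omega), if_neg (by omega), if_neg h1]; simp

end RunPoint

/-! ### Tight points -/

/-- The hypotheses under which the inequality is facet-defining, with the bound on `m` by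
`(Cu - Vb) / V` cleared of the division. -/
structure FacetSetting (T L l : ℤ) (Cl Cu Vb V : ℝ) (t m : ℤ) (S : Finset ℤ) : Prop where
  one_le_L : 1 ≤ L
  one_le_l : 1 ≤ l
  L_lt : L + 1 ≤ T
  Cl_nonneg : 0 ≤ Cl
  Cl_le : Cl ≤ Vb
  V_pos : 0 < V
  one_le_t : 1 ≤ t
  m_nonneg : 0 ≤ m
  m_lower : tHat L t - t - 1 ≤ m
  m_upper : m ≤ T - t - 1
  m_cap : (m : ℝ) * V ≤ Cu - Vb
  S_subset : S ⊆ Icc (tHat L t + 1) (t + m)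
  Cl_lt : Cl < Cu
  room : tHat L t ≤ t + m ∨ (((L - 1) / 2 : ℤ) : ℝ) * V ≤ Cu - Vb

namespace FacetSetting

variable {T L l : ℤ} {Cl Cu Vb V : ℝ} {t m : ℤ} {S : Finset ℤ}

lemma mul_le_of_le_m (h : FacetSetting T L l Cl Cu Vb V t m S) {q : ℤ} (hq : q ≤ m) :
    (q : ℝ) * V ≤ Cu - Vb :=
  (mul_le_mul_of_nonneg_right (by exact_mod_cast hq) h.V_pos.le).trans h.m_cap

/-- The generation bound leaves room for every ramp that a run contributing to `φ` can perform. -/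
lemma mul_le (h : FacetSetting T L l Cl Cu Vb V t m S) {q : ℤ} (h1 : q ≤ t - 2)
    (h2 : 2 * q ≤ L - 1) : (q : ℝ) * V ≤ Cu - Vb := by
  rcases h.room with h3 | h3
  · apply h.mul_le_of_le_m
    unfold tHat at h3
    split_ifs at h3 <;> omega
  · refine le_trans (mul_le_mul_of_nonneg_right ?_ h.V_pos.le) h3
    exact_mod_cast (by omega : q ≤ (L - 1) / 2)

lemma phiCoeff_mul_le (h : FacetSetting T L l Cl Cu Vb V t m S) (a : ℤ) :
    (phiCoeff T L t a : ℝ) * V ≤ Cu - Vb := by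
  by_cases h0 : phiCoeff T L t a ≤ 0
  · exact h.mul_le_of_le_m (h0.trans h.m_nonneg)
  have h1 := h.m_lower
  have h2 := h.m_upper
  apply h.mul_le
  · unfold phiCoeff at h0 ⊢
    split_ifs at h0 ⊢ <;> omega
  · unfold phiCoeff at h0 ⊢
    unfold tHat at h1
    split_ifs at h0 h1 ⊢ <;> omega

/-- A run `[a, b]` after a start-up is tight if every period after `t` that occurs in the inequality
has settled status `0`; it generates `Vb` plus the ramp paid for by `φ`. -/
lemma exists_tight_run (h : FacetSetting T L l Cl Cu Vb V t m S) {a b : ℤ} (ha : 2 ≤ a)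
    (haT : a ≤ T) (hbT : b ≤ T) (hab : b = T ∨ a + L - 1 ≤ b)
    (hset : ∀ i, t < i → i ≤ t + m + 1 → (i ≤ tHat L t ∨ i ∈ insert (t + m + 1) S) →
      onSeq a b i = if i - L + 1 ≤ a ∧ a ≤ i then 1 else 0) :
    ∃ c, Feasible T L l Cl Cu Vb V (runPoint Vb V c t a b) ∧
      (runPoint Vb V c t a b : Point T).x t =
        rhs L Cu Vb V t m S (runPoint Vb V c t a b : Point T) := by
  have hL := h.one_le_L
  have ht := h.one_le_t
  have hmu := h.m_upper
  have hm0 := h.m_nonneg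
  have hV := h.V_pos.le
  have hκ := h.phiCoeff_mul_le a
  have hκ0 : 0 ≤ phiCoeff T L t a := by
    unfold phiCoeff; split_ifs <;> omega
  have hκa : phiCoeff T L t a ≤ |a - t| := by
    unfold phiCoeff; split_ifs <;> simp only [le_abs] <;> omega
  have hκb : b < T → phiCoeff T L t a ≤ |b - t| := by
    intro hb
    unfold phiCoeff; split_ifs <;> simp only [le_abs] <;> omega
  have hκ0' : (0 : ℝ) ≤ phiCoeff T L t a := by exact_mod_cast hκ0
  have hκa' : (phiCoeff T L t a : ℝ) ≤ |(a : ℝ) - t| := by exact_mod_cast hκa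
  have hκb' : b < T → (phiCoeff T L t a : ℝ) ≤ |(b : ℝ) - t| := by exact_mod_cast hκb
  have hnn := mul_nonneg hV hκ0'
  have hVc := h.Cl_le
  refine ⟨Vb + V * phiCoeff T L t a, runPoint_feasible h.one_le_l h.Cl_nonneg h.Cl_le hV (by omega)
    hbT haT (Or.inr hab) (by linarith) (by linarith) (fun _ => ?_) (fun hb => ?_), ?_⟩
  · linarith [mul_le_mul_of_nonneg_left hκa' hV]
  · linarith [mul_le_mul_of_nonneg_left (hκb' hb) hV]
  · rw [rhs_of_settled_eq_zero h.m_lower _ hL h.S_subset]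
    · rw [runPoint, phi_single ha haT (by omega), ← runPoint]
      by_cases htab : a ≤ t ∧ t ≤ b
      · rw [runPoint_x_peak ht (by omega) htab.1 htab.2 (by linarith), runPoint,
          ofFun_y ht (by omega), onSeq, if_pos htab]
        ring
      · rw [runPoint_x_off ht (by omega) (by omega), runPoint, ofFun_y ht (by omega), onSeq,
          if_neg htab, phiCoeff, if_neg (by omega)]
        simp
    · intro i h1 h2 h3
      rw [runPoint, settled_of_u_eq_single ha haT (by omega) (by omega), hset i h1 h2 h3, sub_self]

lemma exists_tight_short_run (h : FacetSetting T L l Cl Cu Vb V t m S) {a : ℤ} (ha : 2 ≤ a)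
    (haT : a ≤ T) : ∃ c, Feasible T L l Cl Cu Vb V (runPoint Vb V c t a (min (a + L - 1) T)) ∧
      (runPoint Vb V c t a (min (a + L - 1) T) : Point T).x t =
        rhs L Cu Vb V t m S (runPoint Vb V c t a (min (a + L - 1) T) : Point T) := by
  have hmu := h.m_upper
  refine h.exists_tight_run ha haT (by omega) (by omega) fun i h1 h2 h3 => ?_
  rw [onSeq]
  exact if_congr (by omega) rfl rfl

/-- A run that exceeds the minimum-up-time by one period is still tight if its last period does not
occur in the inequality. -/
lemma exists_tight_long_run (h : FacetSetting T L l Cl Cu Vb V t m S) {a : ℤ} (ha : 2 ≤ a)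
    (haT : a + L ≤ T) (hth : tHat L t < a + L) (haS : a + L ∉ insert (t + m + 1) S) :
    ∃ c, Feasible T L l Cl Cu Vb V (runPoint Vb V c t a (a + L)) ∧
      (runPoint Vb V c t a (a + L) : Point T).x t =
        rhs L Cu Vb V t m S (runPoint Vb V c t a (a + L) : Point T) := by
  have hL := h.one_le_L
  refine h.exists_tight_run ha (by omega) haT (by omega) fun i h1 h2 h3 => ?_
  have : i ≠ a + L := by
    rintro rfl
    rcases h3 with h3 | h3
    · omega
    · exact haS h3
  rw [onSeq]
  exact if_congr (by omega) rfl rfl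

/-- An initial run is tight if it ends before time `t`, or so that its generation at time `t` is
limited by the shut-down exactly as in `rhs_initial_run`. -/
lemma exists_tight_initial_run (h : FacetSetting T L l Cl Cu Vb V t m S) {b : ℤ} (hbT : b < T)
    (hb : b + 1 ≤ tHat L t ∨ b + 1 ∈ insert (t + m + 1) S) :
    ∃ c, Feasible T L l Cl Cu Vb V (runPoint Vb V c t 1 b) ∧
      (runPoint Vb V c t 1 b : Point T).x t =
        rhs L Cu Vb V t m S (runPoint Vb V c t 1 b : Point T) := by
  have hL := h.one_le_L
  have ht := h.one_le_t
  have hml := h.m_lower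
  have hmu := h.m_upper
  have hm0 := h.m_nonneg
  have hV := h.V_pos.le
  have hcap := h.mul_le_of_le_m h.m_nonneg
  rw [Int.cast_zero, zero_mul] at hcap
  by_cases htb : t ≤ b
  · have hbt : (0 : ℝ) ≤ b - t := by rw [← Int.cast_sub]; exact_mod_cast (by omega : 0 ≤ b - t)
    have hbm : b - t ≤ m := by
      rcases hb with h' | h'
      · omega
      · rcases mem_insert.1 h' with h' | h'
        · omega
        · have := mem_Icc.1 (h.S_subset h'); omega
    have hroom := h.mul_le_of_le_m hbm
    push_cast at hroom
    have hnn := mul_nonneg hV hbt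
    refine ⟨Vb + V * (b - t), runPoint_feasible h.one_le_l h.Cl_nonneg h.Cl_le hV le_rfl
      hbT.le (by omega) (Or.inl rfl) (by linarith) (by linarith)
      (fun h => absurd h (by norm_num)) (fun _ => ?_), ?_⟩
    · rw [abs_of_nonneg hbt]; linarith
    · rw [runPoint_x_peak ht (by omega) ht htb (by linarith), runPoint,
        rhs_initial_run ht hL hml hmu h.S_subset htb hb]
  · refine ⟨Vb, runPoint_feasible h.one_le_l h.Cl_nonneg h.Cl_le hV le_rfl
      hbT.le (by omega) (Or.inl rfl) le_rfl (by linarith)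
      (fun h => absurd h (by norm_num)) (fun _ => ?_), ?_⟩
    · linarith [mul_nonneg hV (abs_nonneg ((b : ℝ) - t))]
    · rw [runPoint_x_off ht (by omega) (by omega), rhs_of_settled_eq_zero hml _ hL h.S_subset]
      · rw [runPoint, ofFun_y ht (by omega), onSeq, if_neg (by omega)]
        simp [phi, ofFun_single_one_u]
      · intro i h1 h2 _
        rw [settled, runPoint, ofFun_y (by omega) (by omega), onSeq, if_neg (by omega)]
        simp [ofFun_single_one_u]

/-- A unit that is always online can run at full capacity except for a reduction by `δ` at a single
time `k`. -/
lemma always_on_feasible (h : FacetSetting T L l Cl Cu Vb V t m S) {δ : ℝ} (hδ : 0 ≤ δ)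
    (hδV : δ ≤ V) (hδC : δ ≤ Cu - Cl) (k : ℤ) :
    Feasible T L l Cl Cu Vb V
      (ofFun (fun i => if i = k then Cu - δ else Cu) (onSeq 1 T) (Pi.single 1 1)) := by
  have hCl := h.Cl_nonneg
  have hL := h.one_le_L
  have hl := h.one_le_l
  have hV := h.V_pos
  have hy : ∀ i, 1 ≤ i → i ≤ T → (ofFun (fun i => if i = k then Cu - δ else Cu) (onSeq 1 T)
      (Pi.single 1 1) : Point T).y i = 1 := fun i h1 h2 => by
    rw [ofFun_y h1 h2, onSeq, if_pos ⟨h1, h2⟩]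
  constructor
  · intro i hi
    rw [mem_Icc] at hi
    rw [ofFun_x hi.1 hi.2]
    split_ifs <;> linarith
  · intro i hi
    rw [mem_Icc] at hi
    exact Or.inr (hy i hi.1 hi.2)
  · intro i _
    exact Or.inl (ofFun_single_one_u i)
  · intro i hi
    rw [mem_Icc] at hi
    simp only [ofFun_single_one_u, sum_const_zero]
    rw [hy i (by omega) hi.2]
    exact zero_le_one
  · intro i hi
    rw [mem_Icc] at hi
    simp only [ofFun_single_one_u, sum_const_zero]
    rw [hy (i - l) (by omega) (by omega), sub_self]
  · intro i hi
    rw [mem_Icc] at hi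
    rw [ofFun_single_one_u, hy i (by omega) hi.2, hy (i - 1) (by omega) (by omega)]
    norm_num
  · intro i hi
    rw [mem_Icc] at hi
    rw [ofFun_x hi.1 hi.2, hy i hi.1 hi.2]
    split_ifs <;> linarith
  · intro i hi
    rw [mem_Icc] at hi
    rw [ofFun_x hi.1 hi.2, hy i hi.1 hi.2]
    split_ifs <;> linarith
  · intro i hi
    rw [mem_Icc] at hi
    rw [ofFun_x (by omega) hi.2, ofFun_x (by omega) (by omega), hy (i - 1) (by omega) (by omega)]
    split_ifs <;> linarith
  · intro i hi
    rw [mem_Icc] at hi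
    rw [ofFun_x (by omega) hi.2, ofFun_x (by omega) (by omega), hy i (by omega) hi.2]
    split_ifs <;> linarith

end FacetSetting

/-! ### The tight points span a hyperplane -/

section Span

variable {T : ℤ}

lemma map_mem_of_single {ι M : Type*} [Fintype ι] [DecidableEq ι] [AddCommGroup M] [Module ℝ M]
    (g : (ι → ℝ) →ₗ[ℝ] M) (W : Submodule ℝ M)
    (h : ∀ i, g (fun j => if i = j then 1 else 0) ∈ W) (q : ι → ℝ) : g q ∈ W := by
  rw [LinearMap.pi_apply_eq_sum_univ g q]
  exact sum_mem fun i _ => W.smul_mem _ (h i)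

lemma single_restrict {s : Finset ℤ} (k : s) :
    (fun j : s => (Pi.single (k : ℤ) 1 : ℤ → ℝ) j) = fun j => if k = j then 1 else 0 := by
  ext j
  rw [Pi.single_apply]
  exact if_congr ⟨fun h => Subtype.ext h.symm, fun h => congrArg _ h.symm⟩ rfl rfl

lemma x_part_mem {W : Submodule ℝ (Point T)}
    (h : ∀ i, 1 ≤ i → i ≤ T → ofFun (Pi.single i 1) 0 0 ∈ W) (q : Icc (1 : ℤ) T → ℝ) :
    ((q, 0, 0) : Point T) ∈ W := by
  refine map_mem_of_single (LinearMap.inl ℝ _ _) W (fun k => ?_) q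
  have := h k (mem_Icc.1 k.2).1 (mem_Icc.1 k.2).2
  rw [ofFun, single_restrict] at this
  exact this

lemma y_part_mem {W : Submodule ℝ (Point T)}
    (h : ∀ i, 1 ≤ i → i ≤ T → ofFun 0 (Pi.single i 1) 0 ∈ W) (q : Icc (1 : ℤ) T → ℝ) :
    ((0, q, 0) : Point T) ∈ W := by
  refine map_mem_of_single (LinearMap.inr ℝ _ _ ∘ₗ LinearMap.inl ℝ _ _) W (fun k => ?_) q
  have := h k (mem_Icc.1 k.2).1 (mem_Icc.1 k.2).2
  rw [ofFun, single_restrict] at this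
  exact this

lemma u_part_mem {W : Submodule ℝ (Point T)}
    (h : ∀ i, 2 ≤ i → i ≤ T → ofFun 0 0 (Pi.single i 1) ∈ W) (q : Icc (2 : ℤ) T → ℝ) :
    ((0, 0, q) : Point T) ∈ W := by
  refine map_mem_of_single (LinearMap.inr ℝ _ _ ∘ₗ LinearMap.inr ℝ _ _) W (fun k => ?_) q
  have := h k (mem_Icc.1 k.2).1 (mem_Icc.1 k.2).2
  rw [ofFun, single_restrict] at this
  exact this

lemma ofFun_single_one_eq (f g : ℤ → ℝ) :
    (ofFun f g (Pi.single 1 1) : Point T) = ofFun f g 0 := by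
  have : (fun i : Icc (2 : ℤ) T => (Pi.single 1 1 : ℤ → ℝ) i) = fun _ => 0 := by
    ext i
    have := (mem_Icc.1 i.2).1
    rw [Pi.single_apply, if_neg (by omega)]
  rw [ofFun, this]
  rfl

lemma onSeq_sub_onSeq {a b : ℤ} (h : a ≤ b) : onSeq a b - onSeq a (b - 1) = Pi.single b 1 := by
  ext i
  rw [Pi.sub_apply, Pi.single_apply, onSeq, onSeq]
  split_ifs <;> first | omega | norm_num

variable {L l : ℤ} {Cl Cu Vb V : ℝ} {t m : ℤ} {S : Finset ℤ}

/-- The tight feasible points together with the unit vector of `x_t` span the whole space. -/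
theorem FacetSetting.eq_top_of_tight_mem (h : FacetSetting T L l Cl Cu Vb V t m S)
    (W : Submodule ℝ (Point T))
    (hW : ∀ p, Feasible T L l Cl Cu Vb V p → p.x t = rhs L Cu Vb V t m S p → p ∈ W)
    (hWt : ofFun (Pi.single t 1) 0 0 ∈ W) : W = ⊤ := by
  have hL := h.one_le_L
  have ht := h.one_le_t
  have hml := h.m_lower
  have hmu := h.m_upper
  have hm0 := h.m_nonneg
  have htc := le_tHat L t hL
  -- All units of `x`: lower one coordinate of the always-on point at full capacity.
  have hx1 : ∀ k, 1 ≤ k → k ≤ T → (ofFun (Pi.single k 1) 0 0 : Point T) ∈ W := by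
    intro k hk1 hkT
    rcases eq_or_ne k t with rfl | hkt
    · exact hWt
    set ε := min V (Cu - Cl)
    have hε : 0 < ε := lt_min h.V_pos (sub_pos.2 h.Cl_lt)
    have hmem : ∀ δ, 0 ≤ δ → δ ≤ ε → (ofFun (fun i => if i = k then Cu - δ else Cu) (onSeq 1 T)
        (Pi.single 1 1) : Point T) ∈ W := by
      intro δ h1 h2
      refine hW _ (h.always_on_feasible h1 (h2.trans (min_le_left _ _))
        (h2.trans (min_le_right _ _)) k) ?_
      rw [rhs_always_on ht hL hml hmu h.S_subset, ofFun_x ht (by omega), if_neg hkt.symm]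
    have hsub := W.smul_mem ε⁻¹ (W.sub_mem (hmem 0 le_rfl hε.le) (hmem ε hε.le le_rfl))
    convert hsub using 1
    rw [ofFun_sub, sub_self, sub_self]
    have : (Pi.single k 1 : ℤ → ℝ) = ε⁻¹ • ((fun i => if i = k then Cu - 0 else Cu) -
        fun i => if i = k then Cu - ε else Cu) := by
      ext i
      simp only [Pi.single_apply, Pi.smul_apply, Pi.sub_apply, smul_eq_mul]
      split_ifs
      · field_simp; ring
      · simp
    rw [this]
    ext <;> simp [ofFun]
  have hx := x_part_mem hx1
  have hrun : ∀ a b, (∃ c, Feasible T L l Cl Cu Vb V (runPoint Vb V c t a b) ∧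
      (runPoint Vb V c t a b : Point T).x t =
        rhs L Cu Vb V t m S (runPoint Vb V c t a b : Point T)) →
      (ofFun 0 (onSeq a b) (Pi.single a 1) : Point T) ∈ W := by
    rintro a b ⟨c, h1, h2⟩
    have := W.sub_mem (hW _ h1 h2) (hx fun i => tentSeq Vb V c t a b i)
    convert this using 1
    ext <;> simp [ofFun, runPoint]
  -- Units of `y` at indices beyond `t̂` that do not occur in the inequality.
  have hy0 : ∀ j, tHat L t < j → j ≤ T → j ∉ insert (t + m + 1) S →
      (ofFun 0 (Pi.single j 1) 0 : Point T) ∈ W := by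
    intro j h1 h2 h3
    have h4 : 2 ≤ j - L := by
      unfold tHat at h1
      split_ifs at h1 <;> omega
    have k1 := hrun _ _ (h.exists_tight_long_run (a := j - L) h4 (by omega) (by omega)
      (by rwa [sub_add_cancel]))
    have k2 := hrun _ _ (h.exists_tight_short_run (a := j - L) h4 (by omega))
    rw [sub_add_cancel] at k1
    rw [min_eq_left (by omega), sub_add_cancel] at k2
    have := W.sub_mem k1 k2
    rwa [ofFun_sub, onSeq_sub_onSeq (by omega), sub_self, sub_self] at this
  -- Initial runs of every length: a run that is not tight is obtained from the next longer one.
  have hinit : ∀ b, b ≤ T → 0 ≤ b → (ofFun 0 (onSeq 1 b) 0 : Point T) ∈ W := by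
    intro b hb
    refine Int.leInductionDown (motive := fun b _ => 0 ≤ b →
      (ofFun 0 (onSeq 1 b) 0 : Point T) ∈ W) ?_ ?_ b hb
    · intro _
      have h1 := hW _ (h.always_on_feasible le_rfl h.V_pos.le (sub_pos.2 h.Cl_lt).le t)
        (by rw [rhs_always_on ht hL hml hmu h.S_subset, ofFun_x ht (by omega)]; simp)
      have := W.sub_mem h1 (hx fun i => if (i : ℤ) = t then Cu - 0 else Cu)
      rw [ofFun_single_one_eq] at this
      convert this using 1
      ext <;> simp [ofFun]
    · intro b hb ih hb0
      have ih := ih (by omega)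
      by_cases hact : b ≤ tHat L t ∨ b ∈ insert (t + m + 1) S
      · have := hrun _ _ (h.exists_tight_initial_run (b := b - 1) (by omega)
          (by rwa [sub_add_cancel]))
        rwa [ofFun_single_one_eq] at this
      · rw [not_or] at hact
        have := W.sub_mem ih (hy0 b (by omega) hb hact.2)
        rwa [ofFun_sub, ← onSeq_sub_onSeq (a := 1) (by omega), sub_sub_cancel, sub_self] at this
  have hy := y_part_mem (W := W) fun j h1 h2 => by
    have := W.sub_mem (hinit j h2 (by omega)) (hinit (j - 1) (by omega) (by omega))
    rwa [ofFun_sub, onSeq_sub_onSeq h1, sub_self] at this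
  -- The runs of minimal length supply the start-ups.
  have hu := u_part_mem (W := W) fun a h1 h2 => by
    have := W.sub_mem (hrun _ _ (h.exists_tight_short_run h1 h2))
      (hy fun i => onSeq a (min (a + L - 1) T) i)
    convert this using 1
    ext <;> simp [ofFun]
  rw [eq_top_iff]
  rintro ⟨p, q, r⟩ _
  have := W.add_mem (hx p) (W.add_mem (hy q) (hu r))
  simpa using this

end Span

/-! ### Linearity and dimension -/

section Linear

variable {T : ℤ}

lemma isLinearMap_x (i : ℤ) : IsLinearMap ℝ fun p : Point T => p.x i := by
  by_cases h : i ∈ Icc (1 : ℤ) T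
  · simp only [Point.x, dif_pos h]; constructor <;> intros <;> simp
  · simp only [Point.x, dif_neg h]; constructor <;> intros <;> simp

lemma isLinearMap_y (i : ℤ) : IsLinearMap ℝ fun p : Point T => p.y i := by
  by_cases h : i ∈ Icc (1 : ℤ) T
  · simp only [Point.y, dif_pos h]; constructor <;> intros <;> simp
  · simp only [Point.y, dif_neg h]; constructor <;> intros <;> simp

lemma isLinearMap_u (i : ℤ) : IsLinearMap ℝ fun p : Point T => p.u i := by
  by_cases h : i ∈ Icc (2 : ℤ) T
  · simp only [Point.u, dif_pos h]; constructor <;> intros <;> simp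
  · simp only [Point.u, dif_neg h]; constructor <;> intros <;> simp

lemma isLinearMap_slack (L : ℤ) (Cu Vb V : ℝ) (t m : ℤ) (S : Finset ℤ) :
    IsLinearMap ℝ fun p : Point T => rhs L Cu Vb V t m S p - p.x t := by
  have hx := fun i => isLinearMap_x (T := T) i
  have hy := fun i => isLinearMap_y (T := T) i
  have hu := fun i => isLinearMap_u (T := T) i
  constructor
  · intro p q
    simp only [rhs, phi, (hx _).map_add, (hy _).map_add, (hu _).map_add, sum_add_distrib, mul_add,
      add_sub_add_comm]
    ring
  · intro c p
    simp only [rhs, phi, (hx _).map_smul, (hy _).map_smul, (hu _).map_smul, smul_eq_mul,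
      mul_left_comm _ c, ← mul_sum, ← mul_sub, ← mul_add]

end Linear

end RampPolytope

open RampPolytope in
theorem mainTheorem9 (T L l : ℤ) (Cl Cu Vb V : ℝ)
    (hL : 1 ≤ L) (hl : 1 ≤ l) (hTL : L + 1 ≤ T) (hTl : l + 1 ≤ T)
    (hCl : 0 ≤ Cl) (hClVb : Cl ≤ Vb) (hVbCu : Vb ≤ Cu) (hV : 0 < V)
    (t m : ℤ) (ht : t ∈ Finset.Icc 1 (T - 1))
    (hm_lower : max (RampPolytope.tHat L t - t - 1) 0 ≤ m)
    (hm_upper : m ≤ T - t - 1) (hm_cap : (m : ℝ) ≤ (Cu - Vb) / V)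
    (S : Finset ℤ) (hS : S ⊆ Finset.Icc (RampPolytope.tHat L t + 1) (t + m)) :
    RampPolytope.IsValid (RampPolytope.convP T L l Cl Cu Vb V)
      (fun p => p.x t) (RampPolytope.rhs L Cu Vb V t m S) ∧
    (Cl < Cu →
      (RampPolytope.tHat L t ≤ t + m ∨ (((L - 1) / 2 : ℤ) : ℝ) * V ≤ Cu - Vb) →
      RampPolytope.IsFacetDefining (RampPolytope.convP T L l Cl Cu Vb V)
        (fun p => p.x t) (RampPolytope.rhs L Cu Vb V t m S)) := by
  have ht' := Finset.mem_Icc.1 ht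
  have hcap := (le_div_iff₀ hV).1 hm_cap
  have hlin := isLinearMap_slack (T := T) L Cu Vb V t m S
  have hvalid : IsValid (convP T L l Cl Cu Vb V) (fun p => p.x t) (rhs L Cu Vb V t m S) := by
    have hsub : convP T L l Cl Cu Vb V ⊆ {p | 0 ≤ rhs L Cu Vb V t m S p - p.x t} := by
      refine convexHull_min (fun p hp => ?_) (convex_halfSpace_ge hlin 0)
      exact sub_nonneg.2 (hp.x_le_rhs hL hl hTL hTl hV ht'.1 (by omega) hm_upper hcap hS)
    exact fun p hp => sub_nonneg.1 (hsub hp)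
  refine ⟨hvalid, fun hlt hroom => ?_⟩
  have h : FacetSetting T L l Cl Cu Vb V t m S :=
    ⟨hL, hl, hTL, hCl, hClVb, hV, ht'.1, by omega, by omega, hm_upper, hcap, hS, hlt, hroom⟩
  set Q := convP T L l Cl Cu Vb V
  set F := {p ∈ Q | p.x t = rhs L Cu Vb V t m S p}
  have hfeas : ∀ p, Feasible T L l Cl Cu Vb V p → p ∈ Q := fun p hp => subset_convexHull ℝ _ hp
  -- The initial run of length `0` is the origin, so the face is a linear section.
  have h0 : (0 : Point T) ∈ F := by
    obtain ⟨c, h1, h2⟩ := h.exists_tight_initial_run (b := 0) (by omega)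
      (Or.inl (by have := le_tHat L t hL; omega))
    have h3 : (runPoint Vb V c t 1 0 : Point T) = 0 := by
      have hon : onSeq 1 0 = 0 := by ext i; rw [onSeq, if_neg (by omega)]; rfl
      have htent : tentSeq Vb V c t 1 0 = 0 := by ext i; rw [tentSeq, if_neg (by omega)]; rfl
      rw [runPoint, ofFun_single_one_eq, hon, htent]
      rfl
    rw [h3] at h1 h2
    exact ⟨hfeas _ h1, h2⟩
  refine ⟨hvalid, ⟨0, h0⟩, ?_⟩
  have hFQ : vectorSpan ℝ F ≤ vectorSpan ℝ Q := vectorSpan_mono ℝ fun p hp => hp.1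
  have htop : vectorSpan ℝ F ⊔ Submodule.span ℝ {(ofFun (Pi.single t 1) 0 0 : Point T)} = ⊤ := by
    apply h.eq_top_of_tight_mem
    · intro p hp hpt
      have : p -ᵥ 0 ∈ vectorSpan ℝ F := vsub_mem_vectorSpan ℝ ⟨hfeas p hp, hpt⟩ h0
      rw [vsub_eq_sub, sub_zero] at this
      exact Submodule.mem_sup_left this
    · exact Submodule.mem_sup_right (Submodule.mem_span_singleton_self _)
  have hlower : Module.finrank ℝ (Point T) ≤ Module.finrank ℝ (vectorSpan ℝ F) + 1 := by
    rw [← finrank_top ℝ (Point T), ← htop]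
    refine (Submodule.finrank_add_le_finrank_add_finrank _ _).trans ?_
    gcongr
    exact (finrank_span_le_card _).trans (by simp)
  -- The slack vanishes on the face but not at the always-on point with `x_t` lowered.
  have hstrict : vectorSpan ℝ F < vectorSpan ℝ Q := by
    refine lt_of_le_of_ne hFQ fun heq => ?_
    have hker : vectorSpan ℝ F ≤ LinearMap.ker (hlin.mk' _) := by
      rw [vectorSpan_def, Submodule.span_le]
      rintro _ ⟨p, hp, q, hq, rfl⟩
      have h1 : rhs L Cu Vb V t m S p - p.x t = 0 := sub_eq_zero.2 hp.2.symm
      have h2 : rhs L Cu Vb V t m S q - q.x t = 0 := sub_eq_zero.2 hq.2.symm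
      simp only [vsub_eq_sub, SetLike.mem_coe, LinearMap.mem_ker, map_sub, IsLinearMap.mk'_apply,
        h1, h2, sub_zero]
    have hε : 0 < min V (Cu - Cl) := lt_min hV (sub_pos.2 hlt)
    have hp := hfeas _ (h.always_on_feasible hε.le (min_le_left _ _) (min_le_right _ _) t)
    have hpv := vsub_mem_vectorSpan ℝ hp h0.1
    rw [vsub_eq_sub, sub_zero, ← heq] at hpv
    have := LinearMap.mem_ker.1 (hker hpv)
    rw [IsLinearMap.mk'_apply, rhs_always_on ht'.1 hL h.m_lower hm_upper hS,
      ofFun_x ht'.1 (by omega), if_pos rfl] at this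
    linarith
  have hlt' : Module.finrank ℝ (vectorSpan ℝ F) < Module.finrank ℝ (vectorSpan ℝ Q) :=
    Submodule.finrank_lt_finrank_of_lt hstrict
  have hle : Module.finrank ℝ (vectorSpan ℝ Q) ≤ Module.finrank ℝ (Point T) :=
    Submodule.finrank_le _
  exact le_antisymm hlt' (hle.trans hlower)
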